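/- Let $h_{ij}\in\mathbb{R}$ ($i,j\in\{1,2,3\}$) and $P\ge 0$. Consider the (real, memoryless) 3-user Gaussian interference channel $$Y_j=\sum_{i=1}^3 h_{ij}X_i+Z_j,\qquad j\in\{1,2,3\},$$ where $h_{ij}$ is the coefficient from transmitter $i$ to receiver $j$, the noise $Z_j\sim\mathcal{N}(0,1)$ is independent of the inputs and i.i.d. over channel uses, and every transmitter has the power constraint $P$. An $(n,2^{nR_1},2^{nR_2},2^{nR_3})$ code consists of message sets $\mathcal{M}_i=\{m\in\mathbb{Z}: 1\le m\le 2^{nR_i}\}$, encoders $f_i:\mathcal{M}_i\to\mathbb{R}^n$ satisfying $\frac1n\sum_{t=1}^n\mathbb{E}[f_i(W_i)_t^2]\le P$, and measurable decoders $g_i:\mathbb{R}^n\to\mathcal{M}_i$, where the messages $W_1,W_2,W_3$ are independent and $W_i$ is uniformly distributed on $\mathcal{M}_i$. A triple $(R_1,R_2,R_3)\in\mathbb{R}^3$ is achievable if there is a sequence of $(n,2^{nR_1},2^{nR_2},2^{nR_3})$ codes, one for each $n$, such that $\Pr[g_i(Y_i^n)\neq W_i]\to0$ as $n\to\infty$ for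 each $i$. The capacity region $\mathcal{C}$ is the closure of the set of achievable triples. For $\mathcal{S}\subseteq\{1,2,3\}$ and $j\in\{1,2,3\}$ let $$\mathcal{C}^M(\mathcal{S},j)=\Big\{(R_i)_{i\in\mathcal{S}}:\ R_i\ge0\ \ \forall i\in\mathcal{S},\ \ \sum_{i\in\mathcal{T}}R_i\le\tfrac12\log_2\Big(1+\sum_{i\in\mathcal{T}}h_{ij}^2P\Big)\ \ \forall\,\mathcal{T}\subseteq\mathcal{S}\Big\}$$ be the capacity region of the Gaussian multiple access channel from the transmitters in $\mathcal{S}$ to receiver $j$. Then $\mathcal{C}\subseteq\overline{\mathcal{C}}$, where $\overline{\mathcal{C}}$ is the set of all $(R_1,R_2,R_3)$ with $R_1,R_2,R_3\geq0$ such that for all $i,j\in\{1,2,3\}$ with $i\neq j$ $$R_i\le\tfrac12\log_2(1+h_{ii}^2P),\qquad\text{and}\qquad (R_i,R_j)\in\mathcal{C}^M(\{i,j\},j)\ \text{ if } h_{ij}^2\ge h_{ii}^2 .$$ -/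

import Mathlib

namespace GaussianIC

/-- The number of messages of a user with rate `R` at block length `n`: the message set is
`{1, …, 2^{nR}}`, that is, the set of the integers `m` with `1 ≤ m ≤ 2^{nR}`. It is empty for
`R < 0` and `n ≥ 1`. -/
noncomputable def numMessages (n : ℕ) (R : ℝ) : ℕ :=
  ⌊(2 : ℝ) ^ ((n : ℝ) * R)⌋₊

/-- An `(n, 2^{nR₁}, 2^{nR₂}, 2^{nR₃})` code with power constraint `P`. The expectation in the
power constraint is over the uniformly distributed message, averaged over the `n` channel uses. -/
structure Code (P : ℝ) (n : ℕ) (R : Fin 3 → ℝ) where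
  /-- the encoding functions -/
  encode : ∀ i : Fin 3, Fin (numMessages n (R i)) → (Fin n → ℝ)
  /-- the decoding functions -/
  decode : ∀ i : Fin 3, (Fin n → ℝ) → Fin (numMessages n (R i))
  measurable_decode : ∀ i, Measurable (decode i)
  power_le : ∀ i,
    (∑ m : Fin (numMessages n (R i)), ∑ t : Fin n, encode i m t ^ 2) / (numMessages n (R i) : ℝ)
      ≤ (n : ℝ) * P

/-- The law of `n` independent standard Gaussian noise variables. -/
noncomputable def noise (n : ℕ) : MeasureTheory.Measure (Fin n → ℝ) :=
  MeasureTheory.Measure.pi fun _ => ProbabilityTheory.gaussianReal 0 1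

/-- The output `Y_j^n` of the channel at receiver `j` for the inputs `x i = X_i^n` and the noise
`z = Z_j^n`. The coefficient from transmitter `i` to receiver `j` is `h i j`. -/
def output (h : Fin 3 → Fin 3 → ℝ) {n : ℕ} (x : Fin 3 → Fin n → ℝ) (j : Fin 3)
    (z : Fin n → ℝ) : Fin n → ℝ :=
  fun t => (∑ i, h i j * x i t) + z t

/-- The average probability of error at receiver `j`: the messages of the three users are
independent and uniformly distributed. -/
noncomputable def Code.errorProb {P : ℝ} {n : ℕ} {R : Fin 3 → ℝ} (h : Fin 3 → Fin 3 → ℝ)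
    (c : Code P n R) (j : Fin 3) : ℝ :=
  (∑ m : (∀ i : Fin 3, Fin (numMessages n (R i))),
      (noise n).real {z | c.decode j (output h (fun i => c.encode i (m i)) j z) ≠ m j})
    / (Fintype.card (∀ i : Fin 3, Fin (numMessages n (R i))) : ℝ)

/-- A rate triple is achievable if some sequence of codes has average error probability tending
to zero. Asking this at each of the three receivers is the same as asking it for the event that
some receiver errs (union bound), whatever the joint law of the noises at different receivers. -/
def Achievable (h : Fin 3 → Fin 3 → ℝ) (P : ℝ) (R : Fin 3 → ℝ) : Prop :=
  ∃ c : ∀ n : ℕ, Code P n R,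
    ∀ j, Filter.Tendsto (fun n => (c n).errorProb h j) Filter.atTop (nhds 0)

/-- The capacity region of the 3-user Gaussian interference channel. -/
def capacityRegion (h : Fin 3 → Fin 3 → ℝ) (P : ℝ) : Set (Fin 3 → ℝ) :=
  closure {R | Achievable h P R}

/-- The capacity region `C^M(S, j)` of the Gaussian multiple access channel from the set `S` of
transmitters to receiver `j`. -/
def macRegion (h : Fin 3 → Fin 3 → ℝ) (P : ℝ) (S : Finset (Fin 3)) (j : Fin 3) : Set (S → ℝ) :=
  {r | (∀ i, 0 ≤ r i) ∧
    ∀ T : Finset S, ∑ i ∈ T, r i ≤ 1 / 2 * Real.logb 2 (1 + ∑ i ∈ T, h i j ^ 2 * P)}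

/-- The outer bound on the capacity region. -/
def outerBound (h : Fin 3 → Fin 3 → ℝ) (P : ℝ) : Set (Fin 3 → ℝ) :=
  {R | (∀ i, 0 ≤ R i) ∧
    ∀ i j, i ≠ j →
      R i ≤ 1 / 2 * Real.logb 2 (1 + h i i ^ 2 * P) ∧
      (h i i ^ 2 ≤ h i j ^ 2 → Finset.restrict {i, j} R ∈ macRegion h P {i, j} j)}

end GaussianIC

/-! The converse rests on a variational form of Fano's inequality. If the decision regions of a
codebook of `M` words `s w` partition the output space, then the Donsker-Varadhan inequality
(`log_mul_integral_le`), applied to the law of the output given `w`, a reference law `ν` and the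
function `log M` on the region of `w`, gives
`log M * ℙ(correct | w) ≤ D(law given w ‖ ν) + (M - 1) * ν(region of w)`.
For `ν` Gaussian with variance `1 + S`, where `S` is the power of the centred codebook, the
divergences average to at most `n / 2 * log (1 + S)`, while the last terms average to at most `1`.
This is `awgn_converse`; it needs neither differential entropy nor mutual information.

For one user the messages of the other two are fixed, so that their signals become a known offset.
For a pair `i`, `j` with `h i i ^ 2 ≤ h i j ^ 2` only the message of the third user is fixed. Receiver
`j` decodes the message of `j`; it then knows every signal but that of `i`, which it receives at least
as strongly as receiver `i` does. So it can scale its output, add noise of its own, and correct the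
known signals to produce an output with the law of the one at receiver `i`
(`Code.le_integral_jointDecode`), from which it decodes the message of `i`. Hence the pairs of
messages index a code for additive Gaussian noise, whose power is at most
`(h i j ^ 2 + h j j ^ 2) * P` once both codebooks are centred (`sum_sq_centred_pair_le`), and
`awgn_converse` bounds the sum rate. Dividing by the block length and letting it grow gives the
bounds for achievable triples. They define a closed set, so they pass to the closure. -/

namespace GaussianIC

open MeasureTheory ProbabilityTheory Filter
open scoped NNReal ENNReal

/-! ### The variational bound for a change of measure -/

/-- The Donsker-Varadhan inequality for the test function `a log M`, where `a` takes values in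
`[0, 1]`: the first term on the right is the divergence of `μ` from `ν`. When `a` is the indicator of
a decoding region, this compares the probability of decoding correctly under the true law `μ` with
that under a reference law `ν`. -/
theorem log_mul_integral_le {Ω : Type*} [MeasurableSpace Ω] {μ ν : Measure Ω}
    [IsProbabilityMeasure μ] [IsProbabilityMeasure ν] {r : Ω → ℝ} (hr : Measurable r)
    (hpos : ∀ y, 0 < r y) (hν : ν = μ.withDensity fun y => ENNReal.ofReal (r y))
    (hlog : Integrable (fun y => Real.log (r y)) μ) {a : Ω → ℝ} (ha : Measurable a)
    (ha0 : ∀ y, 0 ≤ a y) (ha1 : ∀ y, a y ≤ 1) {M : ℝ} (hM : 1 ≤ M) :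
    Real.log M * ∫ y, a y ∂μ ≤ -(∫ y, Real.log (r y) ∂μ) + (M - 1) * ∫ y, a y ∂ν := by
  have hb : ∀ y, ‖a y‖ ≤ 1 := fun y => by rw [Real.norm_of_nonneg (ha0 y)]; exact ha1 y
  have haμ : Integrable a μ := .of_bound ha.aestronglyMeasurable 1 (.of_forall hb)
  have haν : Integrable a ν := .of_bound ha.aestronglyMeasurable 1 (.of_forall hb)
  have key : ∀ f : Ω → ℝ, ∫ y, f y ∂ν = ∫ y, r y * f y ∂μ := fun f => by
    rw [hν, integral_withDensity_eq_integral_toReal_smul hr.ennreal_ofReal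
      (.of_forall fun _ => ENNReal.ofReal_lt_top)]
    simp [ENNReal.toReal_ofReal (hpos _).le]
  have keyI : ∀ f : Ω → ℝ, Integrable f ν → Integrable (fun y => r y * f y) μ := fun f hf => by
    rw [hν, integrable_withDensity_iff_integrable_smul' hr.ennreal_ofReal
      (.of_forall fun _ => ENNReal.ofReal_lt_top)] at hf
    simpa [ENNReal.toReal_ofReal (hpos _).le] using hf
  have h1 : Integrable (fun y => r y * (1 + (M - 1) * a y)) μ :=
    keyI _ ((integrable_const _).add (haν.const_mul _))
  -- `u ≤ eᵘ - 1` at `u = a log M + log r`, and `M ^ a ≤ 1 + a (M - 1)` by convexity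
  have hpt : ∀ y, Real.log M * a y + Real.log (r y) ≤ r y * (1 + (M - 1) * a y) - 1 := fun y => by
    have e1 := Real.add_one_le_exp (Real.log M * a y + Real.log (r y))
    have e2 : M ^ a y ≤ 1 + a y * (M - 1) := by
      have := rpow_one_add_le_one_add_mul_self (s := M - 1) (by linarith) (ha0 y) (ha1 y)
      simpa using this
    rw [Real.exp_add, Real.exp_log (hpos y), ← Real.rpow_def_of_pos (by linarith)] at e1
    nlinarith [hpos y]
  have hint := integral_mono ((haμ.const_mul (Real.log M)).add hlog)
    (h1.sub (integrable_const 1)) hpt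
  simp only [Pi.add_apply, Pi.sub_apply] at hint
  rw [integral_add (haμ.const_mul _) hlog, integral_sub h1 (integrable_const 1), ← key,
    integral_add (integrable_const _) (haν.const_mul _), integral_const_mul, integral_const_mul] at hint
  simp at hint
  linarith

theorem pi_withDensity_ofReal {ι : Type*} [Fintype ι] {X : ι → Type*}
    [∀ i, MeasurableSpace (X i)] {μ ν : ∀ i, Measure (X i)} [∀ i, SigmaFinite (μ i)]
    [∀ i, SigmaFinite (ν i)] {r : ∀ i, X i → ℝ} (hr0 : ∀ i x, 0 ≤ r i x)
    (hr : ∀ i, Integrable (r i) (μ i))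
    (hν : ∀ i, ν i = (μ i).withDensity fun x => ENNReal.ofReal (r i x)) :
    Measure.pi ν = (Measure.pi μ).withDensity fun x => ENNReal.ofReal (∏ i, r i (x i)) := by
  refine Measure.pi_eq fun s hs => ?_
  rw [withDensity_apply _ (.univ_pi hs), Measure.restrict_pi_pi,
    ← ofReal_integral_eq_lintegral_ofReal (Integrable.fintype_prod_dep fun i => (hr i).restrict)
      (.of_forall fun x => Finset.prod_nonneg fun i _ => hr0 i _),
    integral_fintype_prod_eq_prod, ENNReal.ofReal_prod_of_nonneg
      (fun i _ => integral_nonneg (hr0 i))]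
  refine Finset.prod_congr rfl fun i _ => ?_
  rw [hν, withDensity_apply _ (hs i), ofReal_integral_eq_lintegral_ofReal (hr i).restrict
    (.of_forall (hr0 i))]

/-! ### Gaussian log-likelihood ratios -/

theorem gaussianReal_eq_withDensity (m m' : ℝ) {v v' : ℝ≥0} (hv : v ≠ 0) (hv' : v' ≠ 0) :
    gaussianReal m' v' = (gaussianReal m v).withDensity fun y =>
      ENNReal.ofReal (gaussianPDFReal m' v' y / gaussianPDFReal m v y) := by
  have hr : Measurable fun y => ENNReal.ofReal (gaussianPDFReal m' v' y / gaussianPDFReal m v y) :=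
    ((measurable_gaussianPDFReal _ _).div (measurable_gaussianPDFReal _ _)).ennreal_ofReal
  rw [gaussianReal_of_var_ne_zero _ hv, gaussianReal_of_var_ne_zero _ hv',
    ← withDensity_mul _ (measurable_gaussianPDF _ _) hr]
  congr 1
  ext y
  have := gaussianPDFReal_pos m v y hv
  rw [Pi.mul_apply, gaussianPDF_def, gaussianPDF_def, ← ENNReal.ofReal_mul this.le]
  field_simp

theorem integral_sq_sub_gaussianReal (m c : ℝ) (v : ℝ≥0) :
    ∫ y, (y - c) ^ 2 ∂gaussianReal m v = v + (m - c) ^ 2 := by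
  have h := variance_eq_sub (X := fun y => y - c) (μ := gaussianReal m v)
    ((memLp_id_gaussianReal' 2 (by simp)).sub (memLp_const c))
  have hi : Integrable (fun y : ℝ => y) (gaussianReal m v) :=
    (memLp_id_gaussianReal' 1 (by simp)).integrable le_rfl
  rw [variance_sub_const (by fun_prop), variance_fun_id_gaussianReal,
    integral_sub hi (integrable_const c), integral_id_gaussianReal] at h
  simp at h
  linarith

theorem integrable_sq_sub_gaussianReal (m c : ℝ) (v : ℝ≥0) :
    Integrable (fun y => (y - c) ^ 2) (gaussianReal m v) :=
  ((memLp_id_gaussianReal' 2 (by simp)).sub (memLp_const c)).integrable_sq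

theorem log_gaussianPDFReal_ratio (s y : ℝ) {v : ℝ≥0} (hv : v ≠ 0) :
    Real.log (gaussianPDFReal 0 v y / gaussianPDFReal s 1 y) =
      -(1 / 2) * Real.log v + (1 / 2) * (y - s) ^ 2 - 1 / (2 * v) * (y - 0) ^ 2 := by
  have hv' : (0 : ℝ) < v := by positivity
  rw [Real.log_div (gaussianPDFReal_pos _ _ _ hv).ne' (gaussianPDFReal_pos _ _ _ one_ne_zero).ne',
    gaussianPDFReal_def, gaussianPDFReal_def, Real.log_mul (by positivity) (by positivity),
    Real.log_mul (by simp; positivity) (by positivity), Real.log_exp, Real.log_exp, Real.log_inv,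
    Real.log_inv, Real.log_sqrt (by positivity), Real.log_sqrt (by positivity), Real.log_mul (by positivity) hv'.ne']
  simp
  ring

theorem integrable_log_gaussianPDFReal_ratio (s : ℝ) {v : ℝ≥0} (hv : v ≠ 0) :
    Integrable (fun y => Real.log (gaussianPDFReal 0 v y / gaussianPDFReal s 1 y))
      (gaussianReal s 1) := by
  simp_rw [log_gaussianPDFReal_ratio _ _ hv]
  exact ((integrable_const _).add ((integrable_sq_sub_gaussianReal _ _ _).const_mul _)).sub
    ((integrable_sq_sub_gaussianReal _ _ _).const_mul _)

/-- Minus this integral is the divergence of `N(s, 1)` from `N(0, v)`. -/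
theorem integral_log_gaussianPDFReal_ratio (s : ℝ) {v : ℝ≥0} (hv : v ≠ 0) :
    ∫ y, Real.log (gaussianPDFReal 0 v y / gaussianPDFReal s 1 y) ∂gaussianReal s 1 =
      -(1 / 2 * Real.log v - 1 / 2 + (1 + s ^ 2) / (2 * v)) := by
  simp_rw [log_gaussianPDFReal_ratio _ _ hv]
  have hA : Integrable (fun y => -(1 / 2) * Real.log v + 1 / 2 * (y - s) ^ 2) (gaussianReal s 1) :=
    (integrable_const _).add ((integrable_sq_sub_gaussianReal _ _ _).const_mul _)
  rw [integral_sub hA ((integrable_sq_sub_gaussianReal _ _ _).const_mul _),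
    integral_add (integrable_const _) ((integrable_sq_sub_gaussianReal _ _ _).const_mul _),
    integral_const_mul (1 / 2 : ℝ), integral_const_mul (1 / (2 * v : ℝ)),
    integral_sq_sub_gaussianReal, integral_sq_sub_gaussianReal]
  simp
  ring

/-- `log_mul_integral_le` for product measures: the divergences of the factors add up. -/
theorem log_mul_integral_pi_le {ι : Type*} [Fintype ι] {X : ι → Type*}
    [∀ i, MeasurableSpace (X i)] {μ ν : ∀ i, Measure (X i)} [∀ i, IsProbabilityMeasure (μ i)]
    [∀ i, IsProbabilityMeasure (ν i)] {r : ∀ i, X i → ℝ} (hmeas : ∀ i, Measurable (r i))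
    (hpos : ∀ i x, 0 < r i x)
    (hν : ∀ i, ν i = (μ i).withDensity fun x => ENNReal.ofReal (r i x))
    (hlog : ∀ i, Integrable (fun x => Real.log (r i x)) (μ i))
    {a : (∀ i, X i) → ℝ} (ha : Measurable a) (ha0 : ∀ y, 0 ≤ a y) (ha1 : ∀ y, a y ≤ 1)
    {M : ℝ} (hM : 1 ≤ M) :
    Real.log M * ∫ y, a y ∂Measure.pi μ ≤
      -(∑ i, ∫ x, Real.log (r i x) ∂μ i) + (M - 1) * ∫ y, a y ∂Measure.pi ν := by
  have hint : ∀ i, Integrable (r i) (μ i) := fun i => by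
    have h := integrable_const (μ := ν i) (1 : ℝ)
    rw [hν i, integrable_withDensity_iff_integrable_smul' (hmeas i).ennreal_ofReal
      (.of_forall fun _ => ENNReal.ofReal_lt_top)] at h
    simpa [ENNReal.toReal_ofReal (hpos _ _).le] using h
  have hlogprod : ∀ y : ∀ i, X i, Real.log (∏ i, r i (y i)) = ∑ i, Real.log (r i (y i)) :=
    fun y => Real.log_prod fun i _ => (hpos i _).ne'
  have hli : ∀ i ∈ Finset.univ, Integrable (fun y : ∀ i, X i => Real.log (r i (y i)))
      (Measure.pi μ) := fun i _ => integrable_comp_eval (f := fun x => Real.log (r i x)) (hlog i)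
  have main := log_mul_integral_le (r := fun y : ∀ i, X i => ∏ i, r i (y i))
    (Finset.measurable_prod _ fun i _ => (hmeas i).comp (measurable_pi_apply i))
    (fun y => Finset.prod_pos fun i _ => hpos i _)
    (pi_withDensity_ofReal (fun i y => (hpos i y).le) hint hν)
    (by simp_rw [hlogprod]; exact integrable_finsetSum _ hli) ha ha0 ha1 hM
  simp_rw [hlogprod] at main
  rwa [integral_finsetSum _ hli, Finset.sum_congr rfl fun i _ =>
    integral_comp_eval (f := fun x => Real.log (r i x)) (hlog i).aestronglyMeasurable] at main

theorem log_mul_integral_gaussian_le {n : ℕ} (s : Fin n → ℝ) {v : ℝ≥0} (hv : v ≠ 0)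
    {a : (Fin n → ℝ) → ℝ} (ha : Measurable a)
    (ha0 : ∀ y, 0 ≤ a y) (ha1 : ∀ y, a y ≤ 1) {M : ℝ} (hM : 1 ≤ M) :
    Real.log M * ∫ y, a y ∂(Measure.pi fun t => gaussianReal (s t) 1) ≤
      n / 2 * Real.log v - n / 2 + (n + ∑ t, s t ^ 2) / (2 * v)
        + (M - 1) * ∫ y, a y ∂(Measure.pi fun _ => gaussianReal 0 v) := by
  have main := log_mul_integral_pi_le (μ := fun t => gaussianReal (s t) 1)
    (ν := fun _ => gaussianReal 0 v)
    (fun t => (measurable_gaussianPDFReal 0 v).div (measurable_gaussianPDFReal (s t) 1))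
    (fun t y => div_pos (gaussianPDFReal_pos _ _ _ hv) (gaussianPDFReal_pos _ _ _ one_ne_zero))
    (fun t => gaussianReal_eq_withDensity (s t) 0 one_ne_zero hv)
    (fun t => integrable_log_gaussianPDFReal_ratio (s t) hv) ha ha0 ha1 hM
  refine main.trans (le_of_eq ?_)
  congr 1
  simp_rw [Pi.div_apply, integral_log_gaussianPDFReal_ratio _ hv, Finset.sum_neg_distrib,
    Finset.sum_add_distrib, neg_neg, ← Finset.sum_div, Finset.sum_add_distrib]
  simp
  ring

/-! ### Converse for a codebook over additive Gaussian noise -/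

theorem pi_gaussianReal_eq_map_noise {n : ℕ} (s : Fin n → ℝ) :
    (Measure.pi fun t => gaussianReal (s t) 1) = (noise n).map fun z t => s t + z t := by
  rw [noise, Measure.pi_map_pi (fun t => (measurable_const_add (s t)).aemeasurable)]
  simp [gaussianReal_map_const_add]

instance isProbabilityMeasure_noise (n : ℕ) : IsProbabilityMeasure (noise n) := by
  unfold noise
  infer_instance

/-- Converse for a codebook `s` with words indexed by `W`, sent over the channel `Y = s w + Z`. The
decoder is soft: on output `y` it decides for `w` with probability `a w y`. The power is measured
after subtracting an arbitrary offset `c` common to all words. The reference law for the output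
is `N(c, 1 + S)`: the divergences from it average to at most `n / 2 * log (1 + S)`, and under it the
probabilities of deciding for the various `w` sum to at most one. -/
theorem awgn_converse {n : ℕ} {W : Type*} [Fintype W] [Nonempty W] (s : W → Fin n → ℝ)
    (c : Fin n → ℝ) {S : ℝ} (hS : 0 ≤ S)
    (hpow : ∑ w, ∑ t, (s w t - c t) ^ 2 ≤ Fintype.card W * (n * S))
    {a : W → (Fin n → ℝ) → ℝ} (ha : ∀ w, Measurable (a w)) (ha0 : ∀ w y, 0 ≤ a w y)
    (ha1 : ∀ y, ∑ w, a w y ≤ 1) :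
    Real.log (Fintype.card W) * ∑ w, ∫ z, a w (fun t => s w t + z t) ∂noise n ≤
      Fintype.card W * (n * (1 / 2 * Real.log (1 + S)) + 1) := by
  set M : ℝ := (Fintype.card W : ℝ)
  have hM : 1 ≤ M := Nat.one_le_cast.2 (Fintype.card_pos (α := W))
  -- the reference law of the output is centred at `c` with variance `1 + S` in each coordinate
  obtain ⟨v, hv⟩ : ∃ v : ℝ≥0, (v : ℝ) = 1 + S := ⟨⟨1 + S, by positivity⟩, rfl⟩
  have hv0 : v ≠ 0 := by rintro rfl; simp at hv; linarith
  have hcm : Measurable fun (y : Fin n → ℝ) (t : Fin n) => y t + c t := by fun_prop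
  have haw : ∀ w y, a w y ≤ 1 := fun w y =>
    (Finset.single_le_sum (fun w _ => ha0 w y) (Finset.mem_univ w)).trans (ha1 y)
  have ham : ∀ w, Measurable fun y : Fin n → ℝ => a w fun t => y t + c t := fun w => (ha w).comp hcm
  have hshift : ∀ w, ∫ z, a w (fun t => s w t + z t) ∂noise n =
      ∫ y, a w (fun t => y t + c t) ∂(Measure.pi fun t => gaussianReal (s w t - c t) 1) := fun w => by
    rw [pi_gaussianReal_eq_map_noise (fun t => s w t - c t), integral_map
      (Measurable.aemeasurable (by fun_prop)) (ham w).aestronglyMeasurable]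
    refine integral_congr_ae (.of_forall fun z => congrArg (a w) ?_)
    ext t
    ring
  have hw := fun w => log_mul_integral_gaussian_le (fun t => s w t - c t) hv0 (ham w)
    (fun y => ha0 w _) (fun y => haw w _) hM
  have hsum := Finset.sum_le_sum fun w (_ : w ∈ Finset.univ) => hw w
  have hq : ∑ w, ∫ y, a w (fun t => y t + c t) ∂(Measure.pi fun _ : Fin n => gaussianReal 0 v) ≤ 1 := by
    have hi : ∀ w ∈ Finset.univ, Integrable (fun y : Fin n → ℝ => a w fun t => y t + c t)
        (Measure.pi fun _ : Fin n => gaussianReal 0 v) := fun w _ =>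
      .of_bound (ham w).aestronglyMeasurable 1 (.of_forall fun y => by
        rw [Real.norm_of_nonneg (ha0 w _)]; exact haw w _)
    rw [← integral_finsetSum _ hi]
    refine (integral_mono (integrable_finsetSum _ hi) (integrable_const (1 : ℝ))
      fun y => ha1 _).trans ?_
    simp
  simp only [← Finset.mul_sum, Finset.sum_add_distrib, ← Finset.sum_div,
    Finset.sum_const, Finset.card_univ, nsmul_eq_mul, hv] at hsum
  simp_rw [hshift]
  refine hsum.trans ?_
  have e1 : (M * n + ∑ w, ∑ t, (s w t - c t) ^ 2) / (2 * (1 + S)) ≤ M * n / 2 := by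
    rw [div_le_div_iff₀ (by positivity) (by positivity)]
    nlinarith
  nlinarith [mul_le_mul_of_nonneg_left hq (sub_nonneg.2 hM)]

/-! ### Splitting the noise into two independent parts -/

/-- If `α² + β² = 1` and `Z`, `Z'` are independent standard noises, then `α Z + β Z'` is one too. -/
theorem map_prod_noise {n : ℕ} {α β : ℝ} (hαβ : α ^ 2 + β ^ 2 = 1) :
    ((noise n).prod (noise n)).map (fun p t => α * p.1 t + β * p.2 t) = noise n := by
  have h1 : ((gaussianReal 0 1).prod (gaussianReal 0 1)).map (fun p : ℝ × ℝ => α * p.1 + β * p.2) =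
      gaussianReal 0 1 := by
    have hm := gaussianReal_conv_gaussianReal (m₁ := α * 0) (m₂ := β * 0)
      (v₁ := .mk (α ^ 2) (sq_nonneg α) * 1) (v₂ := .mk (β ^ 2) (sq_nonneg β) * 1)
    rw [← gaussianReal_map_const_mul, ← gaussianReal_map_const_mul, Measure.conv,
      Measure.map_prod_map _ _ (by fun_prop) (by fun_prop),
      Measure.map_map (by fun_prop) (by fun_prop)] at hm
    convert hm using 2
    · rfl
    · simp
    · exact NNReal.eq (by simpa using hαβ.symm)
  have h2 := measurePreserving_arrowProdEquivProdArrow ℝ ℝ (Fin n)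
    (fun _ => gaussianReal 0 1) (fun _ => gaussianReal 0 1)
  unfold noise
  rw [← h2.map_eq, Measure.map_map (by fun_prop) h2.measurable]
  have h3 := Measure.pi_map_pi (μ := fun _ : Fin n => (gaussianReal 0 1).prod (gaussianReal 0 1))
    (f := fun _ (p : ℝ × ℝ) => α * p.1 + β * p.2) (fun _ => by fun_prop)
  simp only [h1] at h3
  exact h3

theorem measurable_noise_real {n : ℕ} {Ω : Type*} [MeasurableSpace Ω]
    {f : Ω → (Fin n → ℝ) → (Fin n → ℝ)} (hf : Measurable (Function.uncurry f))
    {A : Set (Fin n → ℝ)} (hA : MeasurableSet A) :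
    Measurable fun y => (noise n).real {z | f y z ∈ A} :=
  (measurable_measure_prodMk_left (hf hA)).ennreal_toReal

theorem integral_noise_real {n : ℕ} {α β : ℝ} (hαβ : α ^ 2 + β ^ 2 = 1)
    {A : Set (Fin n → ℝ)} (hA : MeasurableSet A) :
    ∫ z, (noise n).real {z' | (fun t => α * z t + β * z' t) ∈ A} ∂noise n = (noise n).real A := by
  have hf : Measurable fun (p : (Fin n → ℝ) × (Fin n → ℝ)) t => α * p.1 t + β * p.2 t := by fun_prop
  rw [Measure.real, ← map_prod_noise hαβ, Measure.map_apply hf hA, Measure.prod_apply (hf hA),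
    ← integral_toReal (measurable_measure_prodMk_left (hf hA)).aemeasurable
      (.of_forall fun _ => measure_lt_top _ _), map_prod_noise hαβ]
  rfl

/-! ### Sums over messages, and centring a codebook -/

theorem sum_mul_update {ι : Type*} [Fintype ι] [DecidableEq ι] {M : ι → Type*} (g : ι → ℝ)
    (x : ∀ k, M k → ℝ) (m : ∀ k, M k) (i : ι) (w : M i) :
    ∑ k, g k * x k (Function.update m i w k) =
      ∑ k, g k * x k (m k) + g i * (x i w - x i (m i)) := by
  rw [← sub_eq_iff_eq_add', ← Finset.sum_sub_distrib, Finset.sum_eq_single i]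
  · simp [mul_sub]
  · intro k _ hk
    simp [hk]
  · simp

/-- Resampling one coordinate: the map `(m, w) ↦ (update m i w, m i)` is an involution, so a sum over
`m` and `w` of a function of `update m i w` counts each value of the function equally often. -/
theorem sum_sum_update {ι : Type*} [Fintype ι] [DecidableEq ι] {M : ι → Type*}
    [∀ k, Fintype (M k)] (F : (∀ k, M k) → ℝ) (i : ι) :
    ∑ m, ∑ w, F (Function.update m i w) = Fintype.card (M i) * ∑ m, F m := by
  have hinv : Function.Involutive
      fun p : (∀ k, M k) × M i => (Function.update p.1 i p.2, p.1 i) := fun p => by simp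
  rw [← Fintype.sum_prod_type' fun m w => F (Function.update m i w),
    Fintype.sum_bijective _ hinv.bijective _ (fun p => F p.1) fun p => rfl, Fintype.sum_prod_type]
  simp [Finset.mul_sum]

theorem sum_sub_mean {W : Type*} [Fintype W] [Nonempty W] (f : W → ℝ) :
    ∑ w, (f w - (∑ w, f w) / Fintype.card W) = 0 := by
  simp
  field_simp
  ring

theorem sum_sq_sub_mean_le {W : Type*} [Fintype W] [Nonempty W] (f : W → ℝ) :
    ∑ w, (f w - (∑ w, f w) / Fintype.card W) ^ 2 ≤ ∑ w, f w ^ 2 := by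
  set μ := (∑ w, f w) / Fintype.card W with hμ
  have h0 : ∑ w, (f w - μ) = 0 := sum_sub_mean f
  have h : ∑ w, f w ^ 2 = ∑ w, (f w - μ) ^ 2 + 2 * μ * ∑ w, (f w - μ) + ∑ _w : W, μ ^ 2 := by
    rw [Finset.mul_sum, ← Finset.sum_add_distrib, ← Finset.sum_add_distrib]
    exact Finset.sum_congr rfl fun w _ => by ring
  rw [h, h0]
  have : 0 ≤ ∑ _w : W, μ ^ 2 := Finset.sum_nonneg fun _ _ => sq_nonneg _
  linarith

theorem sum_sq_add_of_sum_eq_zero {A B : Type*} [Fintype A] [Fintype B] {u : A → ℝ} {v : B → ℝ}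
    (hu : ∑ a, u a = 0) (p q : ℝ) :
    ∑ w : A × B, (p * u w.1 + q * v w.2) ^ 2 =
      Fintype.card B * (p ^ 2 * ∑ a, u a ^ 2) + Fintype.card A * (q ^ 2 * ∑ b, v b ^ 2) := by
  have h : ∀ a b, (p * u a + q * v b) ^ 2 =
      p ^ 2 * u a ^ 2 + 2 * p * u a * (q * v b) + q ^ 2 * v b ^ 2 := fun a b => by ring
  simp_rw [Fintype.sum_prod_type, h, Finset.sum_add_distrib, ← Finset.mul_sum, ← Finset.sum_mul,
    ← Finset.mul_sum, hu]
  simp [← Finset.mul_sum, mul_left_comm]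

/-- The power of the superposition of two centred codebooks: the cross terms cancel on summing over
all pairs of words, and centring does not increase the power. -/
theorem sum_sq_centred_pair_le {A B : Type*} [Fintype A] [Fintype B] [Nonempty A] [Nonempty B]
    {n : ℕ} {P : ℝ} {x : A → Fin n → ℝ} {y : B → Fin n → ℝ}
    (hx : ∑ a, ∑ t, x a t ^ 2 ≤ Fintype.card A * (n * P))
    (hy : ∑ b, ∑ t, y b t ^ 2 ≤ Fintype.card B * (n * P)) (p q : ℝ) :
    ∑ w : A × B, ∑ t, (p * (x w.1 t - (∑ a, x a t) / Fintype.card A) +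
        q * (y w.2 t - (∑ b, y b t) / Fintype.card B)) ^ 2 ≤
      (Fintype.card A * Fintype.card B : ℝ) * (n * (p ^ 2 * P + q ^ 2 * P)) := by
  rw [Finset.sum_comm] at hx hy ⊢
  have h : ∀ t, ∑ w : A × B, (p * (x w.1 t - (∑ a, x a t) / Fintype.card A) +
      q * (y w.2 t - (∑ b, y b t) / Fintype.card B)) ^ 2 ≤
        Fintype.card B * (p ^ 2 * ∑ a, x a t ^ 2) + Fintype.card A * (q ^ 2 * ∑ b, y b t ^ 2) :=
    fun t => by
      rw [sum_sq_add_of_sum_eq_zero (u := fun a => x a t - (∑ a, x a t) / Fintype.card A)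
        (v := fun b => y b t - (∑ b, y b t) / Fintype.card B) (sum_sub_mean _)]
      have h1 := sum_sq_sub_mean_le fun a => x a t
      have h2 := sum_sq_sub_mean_le fun b => y b t
      exact add_le_add (by gcongr ?_ * (?_ * ?_)) (by gcongr ?_ * (?_ * ?_))
  refine (Finset.sum_le_sum fun t _ => h t).trans ?_
  rw [Finset.sum_add_distrib, ← Finset.mul_sum, ← Finset.mul_sum, ← Finset.mul_sum,
    ← Finset.mul_sum]
  have h1 := mul_le_mul_of_nonneg_left hx (by positivity : 0 ≤ (Fintype.card B : ℝ) * p ^ 2)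
  have h2 := mul_le_mul_of_nonneg_left hy (by positivity : 0 ≤ (Fintype.card A : ℝ) * q ^ 2)
  linarith

/-- The union bound for the failures of `f` and `g`. -/
theorem integral_add_integral_sub_one_le {Ω : Type*} [MeasurableSpace Ω] {μ : Measure Ω}
    [IsProbabilityMeasure μ] {f g : Ω → ℝ} (hf : Measurable f) (hg : Measurable g)
    (hf0 : ∀ z, 0 ≤ f z) (hf1 : ∀ z, f z ≤ 1) (hg0 : ∀ z, 0 ≤ g z) (hg1 : ∀ z, g z ≤ 1) :
    ∫ z, f z ∂μ + ∫ z, g z ∂μ - 1 ≤ ∫ z, f z * g z ∂μ := by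
  have hfn : ∀ z, ‖f z‖ ≤ 1 := fun z => by rw [Real.norm_of_nonneg (hf0 z)]; exact hf1 z
  have hfi : Integrable f μ := .of_bound hf.aestronglyMeasurable 1 (.of_forall hfn)
  have hgi : Integrable g μ := .of_bound hg.aestronglyMeasurable 1
    (.of_forall fun z => by rw [Real.norm_of_nonneg (hg0 z)]; exact hg1 z)
  have hfg : Integrable (fun z => f z * g z) μ :=
    hgi.bdd_mul hf.aestronglyMeasurable (.of_forall hfn)
  have h : ∫ z, (f z + g z - 1) ∂μ ≤ ∫ z, f z * g z ∂μ :=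
    integral_mono ((hfi.add hgi).sub (integrable_const 1)) hfg fun z => by
      dsimp only
      nlinarith [hf1 z, hg1 z]
  have hfgi : Integrable (fun z => f z + g z) μ := hfi.add hgi
  rw [integral_sub hfgi (integrable_const 1), integral_add hfi hgi] at h
  simpa using h

/-- If `Z` lies in `A` and `α Z + β Z'` lies in `B` with high probability, then so do both jointly;
the probability over `Z'` given `Z` is the factor under the integral. -/
theorem noise_real_add_le {n : ℕ} {α β : ℝ} (hαβ : α ^ 2 + β ^ 2 = 1)
    {A B : Set (Fin n → ℝ)} (hA : MeasurableSet A) (hB : MeasurableSet B) :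
    (noise n).real A + (noise n).real B - 1 ≤
      ∫ z, A.indicator 1 z * (noise n).real {z' | (fun t => α * z t + β * z' t) ∈ B} ∂noise n := by
  have hBm : Measurable fun z : Fin n → ℝ =>
      (noise n).real {z' | (fun t => α * z t + β * z' t) ∈ B} := by
    refine measurable_noise_real (f := fun (z z' : Fin n → ℝ) t => α * z t + β * z' t) ?_ hB
    unfold Function.uncurry
    fun_prop
  rw [← integral_noise_real hαβ hB, ← integral_indicator_one hA]
  exact integral_add_integral_sub_one_le (measurable_one.indicator hA) hBm
    (Set.indicator_nonneg fun _ _ => zero_le_one) (Set.indicator_le_self' fun _ _ => zero_le_one)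
    (fun _ => measureReal_nonneg) (fun _ => measureReal_le_one)

/-! ### Codes for the interference channel at a fixed block length -/

namespace Code

variable {P : ℝ} {n : ℕ} {R : Fin 3 → ℝ}

theorem nonempty_messages (c : Code P n R) (i : Fin 3) : Nonempty (Fin (numMessages n (R i))) :=
  ⟨c.decode i 0⟩

/-- The probability that receiver `j` errs when the messages `m` are sent. -/
noncomputable def errorAt (c : Code P n R) (h : Fin 3 → Fin 3 → ℝ) (j : Fin 3)
    (m : ∀ i : Fin 3, Fin (numMessages n (R i))) : ℝ :=
  (noise n).real {z | c.decode j (output h (fun i => c.encode i (m i)) j z) ≠ m j}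

theorem measurable_output (h : Fin 3 → Fin 3 → ℝ) (x : Fin 3 → Fin n → ℝ) (j : Fin 3) :
    Measurable (output h x j) := by
  unfold output
  fun_prop

theorem noise_real_decode_eq (c : Code P n R) (h : Fin 3 → Fin 3 → ℝ) (j : Fin 3)
    (m : ∀ i : Fin 3, Fin (numMessages n (R i))) :
    (noise n).real {z | c.decode j (output h (fun i => c.encode i (m i)) j z) = m j} =
      1 - c.errorAt h j m := by
  have hm : MeasurableSet {z | c.decode j (output h (fun i => c.encode i (m i)) j z) = m j} :=
    ((c.measurable_decode j).comp (measurable_output h _ j)) (measurableSet_singleton _)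
  have := probReal_compl_eq_one_sub (μ := noise n) hm
  rw [Set.compl_ofPred] at this
  simp only [errorAt, ne_eq, this, sub_sub_cancel]

theorem power_sum_le (c : Code P n R) (i : Fin 3) :
    ∑ m, ∑ t, c.encode i m t ^ 2 ≤ numMessages n (R i) * (n * P) := by
  have := c.nonempty_messages i
  have hpos : (0 : ℝ) < numMessages n (R i) := by exact_mod_cast Fin.pos_iff_nonempty.2 this
  have := c.power_le i
  rwa [div_le_iff₀' hpos] at this

theorem errorProb_eq (c : Code P n R) (h : Fin 3 → Fin 3 → ℝ) (j : Fin 3) :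
    c.errorProb h j = (∑ m, c.errorAt h j m) /
      (Fintype.card (∀ i : Fin 3, Fin (numMessages n (R i))) : ℝ) := rfl

/-- The converse for user `i` when the messages of the other users are the known `m k`, `k ≠ i`. -/
theorem single_converse_at (c : Code P n R) (hP : 0 ≤ P) (h : Fin 3 → Fin 3 → ℝ) (i : Fin 3)
    (m : ∀ i : Fin 3, Fin (numMessages n (R i))) :
    Real.log (numMessages n (R i)) * ∑ w, (1 - c.errorAt h i (Function.update m i w)) ≤
      numMessages n (R i) * (n * (1 / 2 * Real.log (1 + h i i ^ 2 * P)) + 1) := by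
  have := c.nonempty_messages i
  have hdec : ∀ w, MeasurableSet {y | c.decode i y = w} := fun w =>
    c.measurable_decode i (measurableSet_singleton w)
  -- the offset is what receiver `i` gets from the other two transmitters
  have key := awgn_converse (W := Fin (numMessages n (R i)))
    (fun w t => ∑ k, h k i * c.encode k (Function.update m i w k) t)
    (fun t => ∑ k, h k i * c.encode k (m k) t - h i i * c.encode i (m i) t)
    (S := h i i ^ 2 * P) (by positivity) ?_
    (a := fun w => Set.indicator {y | c.decode i y = w} 1)
    (fun w => measurable_one.indicator (hdec w))
    (fun w y => Set.indicator_nonneg (fun _ _ => zero_le_one) y) ?_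
  · rw [Fintype.card_fin] at key
    convert key using 3 with w
    rw [← noise_real_decode_eq, ← integral_indicator_one]
    · congr 1
      ext z
      simp [Set.indicator_apply]
      rfl
    · exact ((c.measurable_decode i).comp (measurable_output h _ i)) (measurableSet_singleton _)
  · rw [Fintype.card_fin]
    have e : ∀ w t, ∑ k, h k i * c.encode k (Function.update m i w k) t -
        (∑ k, h k i * c.encode k (m k) t - h i i * c.encode i (m i) t) =
          h i i * c.encode i w t := fun w t => by
      rw [sum_mul_update (fun k => h k i) (fun k w => c.encode k w t)]
      ring
    simp_rw [e, mul_pow, ← Finset.mul_sum]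
    nlinarith [mul_le_mul_of_nonneg_left (c.power_sum_le i) (sq_nonneg (h i i))]
  · intro y
    simp [Set.indicator_apply]

/-- A transmitter heard with gain `q` can be heard with the smaller gain `p`, by scaling the output by
`α`; the noise is restored to unit variance by adding independent noise of variance `β²`. -/
theorem exists_degrading {p q : ℝ} (hle : p ^ 2 ≤ q ^ 2) :
    ∃ α β : ℝ, α * q = p ∧ α ^ 2 + β ^ 2 = 1 := by
  have h1 : (p / q) ^ 2 ≤ 1 := by
    rw [div_pow]
    exact div_le_one_of_le₀ hle (sq_nonneg _)
  refine ⟨p / q, √(1 - (p / q) ^ 2), ?_, ?_⟩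
  -- if `q = 0`, then `p = 0` too, and the junk value `p / q = 0` serves
  · rcases eq_or_ne q 0 with rfl | h0
    · have : p = 0 := by nlinarith [sq_nonneg p]
      simp [this]
    · field_simp
  · rw [Real.sq_sqrt (by linarith)]
    ring

/-- A soft decision for the messages of users `i` and `j` from the output `y` at receiver `j`. The
message of user `j` is decided by receiver `j`'s own decoder; then the decoder of user `i` is applied
to `α y + β Z + d w.2`, with fresh noise `Z` and a correction `d` depending on the message of `j`.
The value is the probability over `Z` that the decision is `w`. -/
noncomputable def jointDecode (c : Code P n R) (i j : Fin 3) (α β : ℝ)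
    (d : Fin (numMessages n (R j)) → Fin n → ℝ)
    (w : Fin (numMessages n (R i)) × Fin (numMessages n (R j))) (y : Fin n → ℝ) : ℝ :=
  Set.indicator {y | c.decode j y = w.2} 1 y *
    (noise n).real {z | (fun t => α * y t + β * z t + d w.2 t) ∈ {y | c.decode i y = w.1}}

theorem measurableSet_decode (c : Code P n R) (i : Fin 3) (w : Fin (numMessages n (R i))) :
    MeasurableSet {y | c.decode i y = w} :=
  c.measurable_decode i (measurableSet_singleton w)

theorem measurable_jointDecode (c : Code P n R) (i j : Fin 3) (α β : ℝ)
    (d : Fin (numMessages n (R j)) → Fin n → ℝ)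
    (w : Fin (numMessages n (R i)) × Fin (numMessages n (R j))) :
    Measurable (c.jointDecode i j α β d w) := by
  have hB : Measurable fun y : Fin n → ℝ =>
      (noise n).real {z | (fun t => α * y t + β * z t + d w.2 t) ∈ {y | c.decode i y = w.1}} := by
    refine measurable_noise_real
      (f := fun (y z : Fin n → ℝ) t => α * y t + β * z t + d w.2 t) ?_ (c.measurableSet_decode i w.1)
    unfold Function.uncurry
    fun_prop
  exact (measurable_one.indicator (c.measurableSet_decode j w.2)).mul hB

theorem jointDecode_nonneg (c : Code P n R) (i j : Fin 3) (α β : ℝ)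
    (d : Fin (numMessages n (R j)) → Fin n → ℝ)
    (w : Fin (numMessages n (R i)) × Fin (numMessages n (R j))) (y : Fin n → ℝ) :
    0 ≤ c.jointDecode i j α β d w y :=
  mul_nonneg (Set.indicator_nonneg (fun _ _ => zero_le_one) y) measureReal_nonneg

theorem sum_jointDecode (c : Code P n R) (i j : Fin 3) (α β : ℝ)
    (d : Fin (numMessages n (R j)) → Fin n → ℝ) (y : Fin n → ℝ) :
    ∑ w, c.jointDecode i j α β d w y = 1 := by
  have hB : ∀ w2, ∑ w1, (noise n).real
      {z | (fun t => α * y t + β * z t + d w2 t) ∈ {y | c.decode i y = w1}} = 1 := fun w2 => by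
    have hm : Measurable fun z : Fin n → ℝ => c.decode i fun t => α * y t + β * z t + d w2 t :=
      (c.measurable_decode i).comp (by fun_prop)
    have := sum_measureReal_preimage_singleton (μ := noise n) Finset.univ
      (f := fun z : Fin n → ℝ => c.decode i fun t => α * y t + β * z t + d w2 t)
      (fun w _ => hm (measurableSet_singleton w))
    simpa [Set.preimage] using this
  simp_rw [jointDecode, Fintype.sum_prod_type_right, ← Finset.mul_sum, hB]
  simp [Set.indicator_apply]

/-- The hypothesis `hd` makes `α y + β Z + d (m j)` an output of the channel at receiver `i`, so the
joint decision fails with at most the sum of the two error probabilities. -/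
theorem le_integral_jointDecode (c : Code P n R) (h : Fin 3 → Fin 3 → ℝ) {i j : Fin 3}
    {α β : ℝ} (hαβ : α ^ 2 + β ^ 2 = 1) (m : ∀ i : Fin 3, Fin (numMessages n (R i)))
    {d : Fin (numMessages n (R j)) → Fin n → ℝ}
    (hd : ∀ t, d (m j) t = ∑ k, (h k i - α * h k j) * c.encode k (m k) t) :
    1 - c.errorAt h i m - c.errorAt h j m ≤
      ∫ z, c.jointDecode i j α β d (m i, m j) (output h (fun k => c.encode k (m k)) j z)
        ∂noise n := by
  have hm : ∀ k, MeasurableSet {z | c.decode k (output h (fun i => c.encode i (m i)) k z) = m k} :=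
    fun k => ((c.measurable_decode k).comp (measurable_output h _ k)) (measurableSet_singleton _)
  have key := noise_real_add_le hαβ (hm j) (hm i)
  rw [noise_real_decode_eq, noise_real_decode_eq] at key
  refine le_trans (by linarith) (key.trans (le_of_eq ?_))
  refine integral_congr_ae (.of_forall fun z => ?_)
  dsimp only [jointDecode]
  congr 1
  refine congrArg (noise n).real (Set.ext fun z' => ?_)
  change c.decode i _ = m i ↔ c.decode i _ = m i
  have : output h (fun k => c.encode k (m k)) i (fun t => α * z t + β * z' t) =
      fun t => α * output h (fun k => c.encode k (m k)) j z t + β * z' t + d (m j) t := by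
    ext t
    simp only [output, hd, sub_mul, Finset.sum_sub_distrib, mul_assoc, ← Finset.mul_sum]
    ring
  rw [this]

/-- The converse for the sum rate of users `i` and `j` when the message of the third user is known.
The messages `m i` and `m j` play no role. -/
theorem pair_converse_at (c : Code P n R) (hP : 0 ≤ P) (h : Fin 3 → Fin 3 → ℝ) {i j : Fin 3}
    (hij : i ≠ j) (hle : h i i ^ 2 ≤ h i j ^ 2) (m : ∀ i : Fin 3, Fin (numMessages n (R i))) :
    Real.log (numMessages n (R i) * numMessages n (R j)) *
        ∑ w₁, ∑ w₂,
          (1 - c.errorAt h i (Function.update (Function.update m i w₁) j w₂)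
            - c.errorAt h j (Function.update (Function.update m i w₁) j w₂)) ≤
      numMessages n (R i) * numMessages n (R j) *
        (n * (1 / 2 * Real.log (1 + (h i j ^ 2 * P + h j j ^ 2 * P))) + 1) := by
  have := c.nonempty_messages i
  have := c.nonempty_messages j
  obtain ⟨α, β, hα, hαβ⟩ := exists_degrading hle
  let up : Fin (numMessages n (R i)) × Fin (numMessages n (R j)) →
    ∀ k : Fin 3, Fin (numMessages n (R k)) :=
    fun w => Function.update (Function.update m i w.1) j w.2
  have hup : ∀ w, up w = Function.update (Function.update m i w.1) j w.2 := fun _ => rfl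
  have hupi : ∀ w, up w i = w.1 := fun w => by simp [hup, hij]
  have hupj : ∀ w, up w j = w.2 := fun w => by simp [hup]
  let d : Fin (numMessages n (R j)) → Fin n → ℝ := fun w t =>
    ∑ k, (h k i - α * h k j) * c.encode k (Function.update m j w k) t
  have hd : ∀ w t, d (up w j) t = ∑ k, (h k i - α * h k j) * c.encode k (up w k) t := fun w t => by
    -- the coefficient at `k = i` vanishes, so the correction does not depend on `w.1`
    rw [hupj, hup, Function.update_comm hij]
    rw [sum_mul_update (fun k => h k i - α * h k j) (fun k w => c.encode k w t) _ i, hα]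
    simp [d]
  -- the offset is the contribution of the third user plus the means of the two codebooks
  have hpow : ∑ w, ∑ t, ((∑ k, h k j * c.encode k (up w k) t) -
      (∑ k, h k j * c.encode k (m k) t
        - h i j * (c.encode i (m i) t -
          (∑ w, c.encode i w t) / Fintype.card (Fin (numMessages n (R i))))
        - h j j * (c.encode j (m j) t -
          (∑ w, c.encode j w t) / Fintype.card (Fin (numMessages n (R j)))))) ^ 2 ≤
      Fintype.card (Fin (numMessages n (R i)) × Fin (numMessages n (R j))) *
        (n * (h i j ^ 2 * P + h j j ^ 2 * P)) := by
    have := sum_sq_centred_pair_le (x := c.encode i) (y := c.encode j) (P := P)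
      (by simpa using c.power_sum_le i) (by simpa using c.power_sum_le j) (h i j) (h j j)
    rw [Fintype.card_prod, Nat.cast_mul]
    convert this using 5 with w _ t _
    rw [hup, sum_mul_update (fun k => h k j) (fun k w => c.encode k w t),
      sum_mul_update (fun k => h k j) (fun k w => c.encode k w t), Function.update_of_ne hij.symm]
    ring
  have key := awgn_converse _ _ (by positivity) hpow
    (c.measurable_jointDecode i j α β d) (c.jointDecode_nonneg i j α β d)
    (fun y => (c.sum_jointDecode i j α β d y).le)
  rw [Fintype.card_prod, Fintype.card_fin, Fintype.card_fin, Nat.cast_mul] at key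
  rw [← Fintype.sum_prod_type' fun w₁ w₂ =>
    (1 - c.errorAt h i (Function.update (Function.update m i w₁) j w₂)
      - c.errorAt h j (Function.update (Function.update m i w₁) j w₂))]
  refine le_trans (mul_le_mul_of_nonneg_left (Finset.sum_le_sum fun w _ => ?_) ?_) key
  · have := c.le_integral_jointDecode h hαβ (up w) (hd w)
    rw [hupi, hupj] at this
    exact this
  · rw [← Nat.cast_mul]
    exact Real.log_natCast_nonneg _

theorem single_converse (c : Code P n R) (hP : 0 ≤ P) (h : Fin 3 → Fin 3 → ℝ) (i : Fin 3) :
    Real.log (numMessages n (R i)) * (1 - c.errorProb h i) ≤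
      n * (1 / 2 * Real.log (1 + h i i ^ 2 * P)) + 1 := by
  have hne := c.nonempty_messages
  have hpos : ∀ i, (0 : ℝ) < numMessages n (R i) := fun i => by
    exact_mod_cast Fin.pos_iff_nonempty.2 (hne i)
  set N : ℝ := (Fintype.card (∀ i : Fin 3, Fin (numMessages n (R i))) : ℝ) with hN
  have hNpos : 0 < N := by rw [hN]; exact_mod_cast Fintype.card_pos
  have hsum := Finset.sum_le_sum fun m (_ : m ∈ Finset.univ) => c.single_converse_at hP h i m
  rw [← Finset.mul_sum, sum_sum_update (fun m => 1 - c.errorAt h i m), Fintype.card_fin,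
    Finset.sum_const, Finset.card_univ, nsmul_eq_mul, ← hN, mul_left_comm, mul_left_comm N] at hsum
  have hsum := le_of_mul_le_mul_left hsum (hpos i)
  rw [Finset.sum_sub_distrib, Finset.sum_const, Finset.card_univ, nsmul_eq_mul, ← hN] at hsum
  refine le_of_mul_le_mul_left (le_trans (le_of_eq ?_) hsum) hNpos
  rw [errorProb_eq, ← hN]
  field_simp

theorem pair_converse (c : Code P n R) (hP : 0 ≤ P) (h : Fin 3 → Fin 3 → ℝ) {i j : Fin 3}
    (hij : i ≠ j) (hle : h i i ^ 2 ≤ h i j ^ 2) :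
    Real.log (numMessages n (R i) * numMessages n (R j)) *
        (1 - (c.errorProb h i + c.errorProb h j)) ≤
      n * (1 / 2 * Real.log (1 + (h i j ^ 2 * P + h j j ^ 2 * P))) + 1 := by
  have hne := c.nonempty_messages
  have hpos : ∀ i, (0 : ℝ) < numMessages n (R i) := fun i => by
    exact_mod_cast Fin.pos_iff_nonempty.2 (hne i)
  set N : ℝ := (Fintype.card (∀ i : Fin 3, Fin (numMessages n (R i))) : ℝ) with hN
  have hNpos : 0 < N := by rw [hN]; exact_mod_cast Fintype.card_pos
  have hsum := Finset.sum_le_sum fun m (_ : m ∈ Finset.univ) =>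
    c.pair_converse_at hP h hij hle m
  rw [← Finset.mul_sum,
    sum_sum_update (fun m => ∑ w₂, (1 - c.errorAt h i (Function.update m j w₂)
      - c.errorAt h j (Function.update m j w₂))) i,
    sum_sum_update (fun m => 1 - c.errorAt h i m - c.errorAt h j m) j, Fintype.card_fin,
    Fintype.card_fin, Finset.sum_const, Finset.card_univ, nsmul_eq_mul, ← hN, ← mul_assoc
    (numMessages n (R i) : ℝ), mul_left_comm, mul_left_comm N] at hsum
  have hsum := le_of_mul_le_mul_left hsum (mul_pos (hpos i) (hpos j))
  rw [Finset.sum_sub_distrib, Finset.sum_sub_distrib, Finset.sum_const, Finset.card_univ,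
    nsmul_eq_mul, ← hN] at hsum
  refine le_of_mul_le_mul_left (le_trans (le_of_eq ?_) hsum) hNpos
  rw [errorProb_eq, errorProb_eq, ← hN]
  field_simp
  ring

/-- The decoder takes values in the message set, which is therefore not empty. -/
theorem one_le_numMessages (c : Code P n R) (i : Fin 3) : 1 ≤ numMessages n (R i) :=
  Fin.pos_iff_nonempty.2 (c.nonempty_messages i)

theorem le_log_numMessages (c : Code P n R) (i : Fin 3) :
    n * (R i * Real.log 2) - Real.log 2 ≤ Real.log (numMessages n (R i)) := by
  have h1 : (1 : ℝ) ≤ numMessages n (R i) := by exact_mod_cast c.one_le_numMessages i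
  have h2 : (2 : ℝ) ^ ((n : ℝ) * R i) ≤ 2 * numMessages n (R i) := by
    have := (Nat.lt_floor_add_one ((2 : ℝ) ^ ((n : ℝ) * R i))).le
    rw [numMessages] at h1 ⊢
    linarith
  have h3 := Real.log_le_log (by positivity) h2
  rw [Real.log_rpow two_pos, Real.log_mul two_ne_zero (by positivity)] at h3
  linarith

/-- A negative rate leaves no messages at block length one. -/
theorem rate_nonneg (c : Code P 1 R) (i : Fin 3) : 0 ≤ R i := by
  have h := c.one_le_numMessages i
  rw [numMessages, Nat.one_le_floor_iff, Nat.cast_one, one_mul] at h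
  by_contra! hR
  exact (Real.rpow_lt_one_of_one_lt_of_neg one_lt_two hR).not_ge h

end Code

/-! ### The limit of large block length -/

theorem le_of_forall_mul_one_sub_le {r C k : ℝ} {L ε : ℕ → ℝ} (hε : Tendsto ε atTop (nhds 0))
    (hL : ∀ n : ℕ, n * r - k ≤ L n) (h : ∀ n : ℕ, L n * (1 - ε n) ≤ n * C + 1) : r ≤ C := by
  have h1 : Tendsto (fun n : ℕ => (r - k / n) * (1 - ε n)) atTop (nhds ((r - 0) * (1 - 0))) :=
    (tendsto_const_nhds.sub (tendsto_const_div_atTop_nhds_zero_nat k)).mul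
      (tendsto_const_nhds.sub hε)
  have h2 : Tendsto (fun n : ℕ => C + 1 / (n : ℝ)) atTop (nhds (C + 0)) :=
    tendsto_const_nhds.add (tendsto_const_div_atTop_nhds_zero_nat 1)
  have h3 : ∀ᶠ n : ℕ in atTop, (r - k / n) * (1 - ε n) ≤ C + 1 / (n : ℝ) := by
    filter_upwards [hε.eventually_lt_const one_pos, eventually_gt_atTop 0] with n hn hn0
    have hn0 : (0 : ℝ) < n := by exact_mod_cast hn0
    have := (mul_le_mul_of_nonneg_right (hL n) (sub_nonneg.2 hn.le)).trans (h n)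
    rw [show (r - k / n) * (1 - ε n) = (n * r - k) * (1 - ε n) / n by field_simp,
      div_le_iff₀ hn0]
    refine this.trans (le_of_eq ?_)
    field_simp
  simpa using le_of_tendsto_of_tendsto h1 h2 h3

theorem Achievable.rate_le {h : Fin 3 → Fin 3 → ℝ} {P : ℝ} {R : Fin 3 → ℝ} (hP : 0 ≤ P)
    (hR : Achievable h P R) (i : Fin 3) : R i ≤ 1 / 2 * Real.logb 2 (1 + h i i ^ 2 * P) := by
  obtain ⟨c, hc⟩ := hR
  have := le_of_forall_mul_one_sub_le (hc i) (fun n => (c n).le_log_numMessages i)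
    (fun n => (c n).single_converse hP h i)
  rwa [Real.logb, ← mul_div_assoc, le_div_iff₀ (Real.log_pos one_lt_two)]

theorem Achievable.rate_add_rate_le {h : Fin 3 → Fin 3 → ℝ} {P : ℝ} {R : Fin 3 → ℝ} (hP : 0 ≤ P)
    (hR : Achievable h P R) {i j : Fin 3} (hij : i ≠ j) (hle : h i i ^ 2 ≤ h i j ^ 2) :
    R i + R j ≤ 1 / 2 * Real.logb 2 (1 + (h i j ^ 2 * P + h j j ^ 2 * P)) := by
  obtain ⟨c, hc⟩ := hR
  have hε := (hc i).add (hc j)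
  rw [add_zero] at hε
  have := le_of_forall_mul_one_sub_le (r := (R i + R j) * Real.log 2) (k := 2 * Real.log 2) hε
    (fun n => by
      have hi : (numMessages n (R i) : ℝ) ≠ 0 := by
        exact_mod_cast (Nat.one_le_iff_ne_zero.1 ((c n).one_le_numMessages i))
      have hj : (numMessages n (R j) : ℝ) ≠ 0 := by
        exact_mod_cast (Nat.one_le_iff_ne_zero.1 ((c n).one_le_numMessages j))
      rw [Real.log_mul hi hj]
      linarith [(c n).le_log_numMessages i, (c n).le_log_numMessages j])
    (fun n => (c n).pair_converse hP h hij hle)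
  rwa [Real.logb, ← mul_div_assoc, le_div_iff₀ (Real.log_pos one_lt_two)]

theorem mem_macRegion_pair {h : Fin 3 → Fin 3 → ℝ} {P : ℝ} {R : Fin 3 → ℝ} {i j : Fin 3}
    (hij : i ≠ j) (h0 : ∀ k, 0 ≤ R k)
    (hi : R i ≤ 1 / 2 * Real.logb 2 (1 + h i j ^ 2 * P))
    (hj : R j ≤ 1 / 2 * Real.logb 2 (1 + h j j ^ 2 * P))
    (hs : R i + R j ≤ 1 / 2 * Real.logb 2 (1 + (h i j ^ 2 * P + h j j ^ 2 * P))) :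
    Finset.restrict {i, j} R ∈ macRegion h P {i, j} j := by
  refine ⟨fun k => h0 k, fun T => ?_⟩
  have hsum : ∀ f : Fin 3 → ℝ, ∑ k ∈ T, f k =
      ∑ k ∈ T.map (Function.Embedding.subtype _), f k := fun f => by simp
  have hT : T.map (Function.Embedding.subtype _) ⊆ {i, j} := fun k hk => by
    obtain ⟨a, -, rfl⟩ := Finset.mem_map.1 hk
    exact a.2
  simp only [Finset.restrict]
  rw [hsum R, hsum fun k => h k j ^ 2 * P]
  generalize T.map (Function.Embedding.subtype _) = U at hT
  rw [← Finset.coe_subset, Finset.coe_pair, Set.subset_pair_iff_eq] at hT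
  norm_cast at hT
  rcases hT with rfl | rfl | rfl | rfl
  · simp
  · simpa using hi
  · simpa using hj
  · simpa [Finset.sum_pair hij] using hs

end GaussianIC

theorem lemma1 (h : Fin 3 → Fin 3 → ℝ) (P : ℝ) (hP : 0 ≤ P) :
    GaussianIC.capacityRegion h P ⊆ GaussianIC.outerBound h P := by
  -- the bounds for achievable triples, as a set that is visibly closed
  let K : Set (Fin 3 → ℝ) := {R | (∀ i, 0 ≤ R i) ∧
    (∀ i, R i ≤ 1 / 2 * Real.logb 2 (1 + h i i ^ 2 * P)) ∧
    ∀ i j, i ≠ j → h i i ^ 2 ≤ h i j ^ 2 →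
      R i + R j ≤ 1 / 2 * Real.logb 2 (1 + (h i j ^ 2 * P + h j j ^ 2 * P))}
  have hK : IsClosed K := by
    simp only [K, Set.ofPred_and, Set.ofPred_forall]
    refine .inter (isClosed_iInter fun i => ?_) (.inter (isClosed_iInter fun i => ?_)
      (isClosed_iInter fun i => isClosed_iInter fun j => isClosed_iInter fun _ =>
        isClosed_iInter fun _ => ?_)) <;>
    exact isClosed_le (by fun_prop) (by fun_prop)
  have hsub : {R | GaussianIC.Achievable h P R} ⊆ K := fun R hR =>
    ⟨fun i => (hR.choose 1).rate_nonneg i, hR.rate_le hP,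
      fun i j hij hle => hR.rate_add_rate_le hP hij hle⟩
  intro R hR
  obtain ⟨h0, h1, h2⟩ := closure_minimal hsub hK hR
  refine ⟨h0, fun i j hij => ⟨h1 i, fun hle =>
    GaussianIC.mem_macRegion_pair hij h0 ?_ (h1 j) (h2 i j hij hle)⟩⟩
  refine (h1 i).trans ?_
  gcongr
  norm_num
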